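/- Let $W$ be a measurable space of parameters with a commutative group structure whose translations are measurable (for instance $W=\mathbb{R}^p$), let $\mathcal{X}$ be a measurable space, $k\ge 1$, and let $f_{w}:\mathcal{X}\to\mathbb{R}^k$, $w\in W$, be any family of predictors such that $(w,x)\mapsto f_w(x)$ is measurable. Let $\mathcal{D}$ be a probability distribution on $\mathcal{X}\times\{1,\dots,k\}$ and $m\ge 2$. For $\gamma\ge 0$ let $$L_\gamma(f_w)=\mathbb{P}_{(x,y)\sim\mathcal{D}}\Bigl[f_w(x)[y]\le\gamma+\max_{j\ne y}f_w(x)[j]\Bigr]$$ (with $\max\emptyset=-\infty$), and for a sample $S=((x_1,y_1),\dots,(x_m,y_m))$ let $\widehat L_\gamma(f_w)$ be the fraction of indices $i$ with $f_w(x_i)[y_i]\le\gamma+\max_{j\ne y_i}f_w(x_i)[j]$. Let $P$ be any probability distribution on $W$, chosen independently of the sample. Then for all $\gamma,\delta>0$, with probability at least $1-\delta$ over the draw of $S\sim\mathcal{D}^m$, the following holds simultaneously for every $w\in W$ and every random perturbation $u$ in $W$ (both of which, including the law of $u$, may depend on $S$) such that $$\mathbb{P}_u\Bigl[\sup_{x\in\mathcal{X}}\,|f_{w+u}(x)-f_w(x)|_\infty<\tfrac{\gamma}{4}\Bigr]\ge\tfrac12:$$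 $$L_0(f_w)\le\widehat L_\gamma(f_w)+4\sqrt{\frac{\mathrm{KL}(w+u\,\|\,P)+\ln\frac{6m}{\delta}}{m-1}}.$$ Here $\mathrm{KL}(w+u\,\|\,P)$ is the Kullback–Leibler divergence from the law of $w+u$, with $w$ fixed and only $u$ random, to $P$; when it is $+\infty$ the right-hand side is $+\infty$ and the bound holds trivially. -/

import Mathlib

open MeasureTheory

namespace PACBayesMargin

/-- The labelled points `(x, y)` at which the score function `g` fails to have margin `γ`:
`g(x)[y] ≤ γ + max_{j ≠ y} g(x)[j]`. The maximum is taken in `EReal`, so that it is `-∞` when there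
is no other class. -/
def errorSet {X : Type*} {k : ℕ} (γ : ℝ) (g : X → Fin k → ℝ) : Set (X × Fin k) :=
  {z | ((g z.1 z.2 : ℝ) : EReal) ≤ (γ : EReal) + ⨆ (j : Fin k) (_ : j ≠ z.2), ((g z.1 j : ℝ) : EReal)}

/-- The maximum over the other classes is attained. -/
theorem mem_errorSet_iff {X : Type*} {k : ℕ} (γ : ℝ) (g : X → Fin k → ℝ) (z : X × Fin k) :
    z ∈ errorSet γ g ↔ ∃ j, j ≠ z.2 ∧ g z.1 z.2 ≤ γ + g z.1 j := by
  constructor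
  · intro h
    by_contra! hne
    by_cases hk : ∃ j : Fin k, j ≠ z.2
    · obtain ⟨j₀, hj₀⟩ := hk
      obtain ⟨j, hj, hmax⟩ := Finset.exists_max_image
        (Finset.univ.filter fun j : Fin k => j ≠ z.2) (fun j => g z.1 j) ⟨j₀, by simpa using hj₀⟩
      have hj' : j ≠ z.2 := by simpa using hj
      have hsup : (⨆ (i : Fin k) (_ : i ≠ z.2), ((g z.1 i : ℝ) : EReal)) ≤ ((g z.1 j : ℝ) : EReal) :=
        iSup₂_le fun i hi => EReal.coe_le_coe_iff.2 (hmax i (by simpa using hi))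
      have h2 : ((g z.1 z.2 : ℝ) : EReal) ≤ (γ : EReal) + ((g z.1 j : ℝ) : EReal) :=
        le_trans h (by gcongr)
      have h3 : g z.1 z.2 ≤ γ + g z.1 j := by exact_mod_cast h2
      exact absurd h3 (not_le.2 (hne j hj'))
    · push Not at hk
      have hbot : (⨆ (i : Fin k) (_ : i ≠ z.2), ((g z.1 i : ℝ) : EReal)) = ⊥ :=
        le_bot_iff.1 (iSup₂_le fun i hi => absurd (hk i) hi)
      have h2 : ((g z.1 z.2 : ℝ) : EReal) ≤
          (γ : EReal) + ⨆ (j : Fin k) (_ : j ≠ z.2), ((g z.1 j : ℝ) : EReal) := h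
      rw [hbot, EReal.add_bot, le_bot_iff] at h2
      exact EReal.coe_ne_bot _ h2
  · rintro ⟨j, hj, h⟩
    have h1 : ((g z.1 z.2 : ℝ) : EReal) ≤ (γ : EReal) + ((g z.1 j : ℝ) : EReal) := by
      exact_mod_cast h
    refine le_trans h1 ?_
    gcongr
    exact le_iSup₂_of_le (f := fun (i : Fin k) (_ : i ≠ z.2) => ((g z.1 i : ℝ) : EReal)) j hj le_rfl

/-- The expected margin loss `L_γ(g) = P_{(x,y) ∼ D}[g(x)[y] ≤ γ + max_{j ≠ y} g(x)[j]]`. -/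
noncomputable def marginLoss {X : Type*} [MeasurableSpace X] {k : ℕ}
    (D : Measure (X × Fin k)) (γ : ℝ) (g : X → Fin k → ℝ) : ℝ :=
  D.real (errorSet γ g)

/-- The empirical margin loss on the sample `S`: the fraction of sample points in the error set. -/
noncomputable def empiricalMarginLoss {X : Type*} {k m : ℕ}
    (S : Fin m → X × Fin k) (γ : ℝ) (g : X → Fin k → ℝ) : ℝ :=
  (1 / (m : ℝ)) * ∑ i, (errorSet γ g).indicator (fun _ => (1 : ℝ)) (S i)

/-- `sup_x |g(x) - h(x)|_∞`, as an extended nonnegative real. The norm on `Fin k → ℝ` is the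
sup norm. -/
noncomputable def supDist {X : Type*} {k : ℕ} (g h : X → Fin k → ℝ) : ENNReal :=
  ⨆ x, ‖g x - h x‖ₑ

end PACBayesMargin

open MeasureTheory ProbabilityTheory InformationTheory

namespace PACBayesMargin

/-! Let Δ be the gap `L_0 - L̂_γ` at `w`. Scores within γ/4 change a margin by less than γ/2, so
every good perturbation `w + u` has a gap of at least Δ at the intermediate margin γ/2. The set A of
parameters with such a gap thus has posterior mass at least 1/2, and by Fenchel–Young for KL its
prior mass is at least exp(-(2 KL + 2)) (`exp_neg_klDiv_le_measureReal`). Conversely, Hoeffding's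
lemma, Fubini and Markov bound the prior average of exp(t · gap - t²/(8m)) with high probability,
which makes A rare under P. The best exponent t = 4mΔ depends on the sample and the posterior, so
`exists_set_forall_lintegral_exp_le` controls a fixed grid of exponents at once. Comparing the two
bounds on P(A) gives mΔ² ≤ KL + ln(6m/δ). -/

/-! ### Change of measure. -/

/-- The Fenchel–Young inequality for `klFun`, whose convex conjugate is `t ↦ exp t - 1`. -/
theorem mul_le_klFun_add_exp_sub_one {x : ℝ} (hx : 0 ≤ x) (t : ℝ) :
    t * x ≤ klFun x + (Real.exp t - 1) := by
  rw [klFun_apply]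
  rcases hx.eq_or_lt with rfl | hx
  · simp [Real.exp_nonneg]
  · have h1 := Real.add_one_le_exp (t - Real.log x)
    rw [Real.exp_sub, Real.exp_log hx, le_div_iff₀ hx] at h1
    linarith

/-- A change of measure inequality for events. -/
theorem mul_measureReal_le_toReal_klDiv_add {α : Type*} [MeasurableSpace α] {μ ν : Measure α}
    [IsFiniteMeasure μ] [IsFiniteMeasure ν] (h : klDiv μ ν ≠ ⊤) (A : Set α)
    (t : ℝ) :
    t * μ.real A ≤ (klDiv μ ν).toReal + (Real.exp t - 1) * ν.real A := by
  obtain ⟨hac, hint⟩ := klDiv_ne_top_iff.1 h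
  have hkl : Integrable (fun x => klFun (μ.rnDeriv ν x).toReal) ν :=
    (integrable_klFun_rnDeriv_iff hac).2 hint
  rw [toReal_klDiv_eq_integral_klFun hac, ← Measure.setIntegral_toReal_rnDeriv hac A,
    ← integral_const_mul]
  calc ∫ x in A, t * (μ.rnDeriv ν x).toReal ∂ν
      ≤ ∫ x in A, (klFun (μ.rnDeriv ν x).toReal + (Real.exp t - 1)) ∂ν :=
        integral_mono (Measure.integrable_toReal_rnDeriv.integrableOn.const_mul t)
          (hkl.integrableOn.add (integrable_const _))
          fun x => mul_le_klFun_add_exp_sub_one ENNReal.toReal_nonneg t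
    _ = ∫ x in A, klFun (μ.rnDeriv ν x).toReal ∂ν + (Real.exp t - 1) * ν.real A := by
        rw [integral_add hkl.integrableOn (integrable_const _)]
        simp [mul_comm]
    -- Since `klFun` is nonnegative, its integral over A is at most that over the whole space.
    _ ≤ _ := by
        gcongr
        · exact ae_of_all _ fun x => klFun_nonneg ENNReal.toReal_nonneg
        · exact Measure.restrict_le_self

/-- An event of `μ`-probability at least one half cannot be too rare under `ν`. -/
theorem exp_neg_klDiv_le_measureReal {α : Type*} [MeasurableSpace α] {μ ν : Measure α}
    [IsProbabilityMeasure μ] [IsProbabilityMeasure ν] (h : klDiv μ ν ≠ ⊤) {A : Set α}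
    (hμA : 1 / 2 ≤ μ.real A) :
    Real.exp (-(2 * (klDiv μ ν).toReal + 2)) ≤ ν.real A := by
  have hpos : 0 < ν.real A := by
    refine lt_of_le_of_ne measureReal_nonneg fun h0 => ?_
    have h1 : ν A = 0 := by
      rwa [eq_comm, measureReal_eq_zero_iff] at h0
    have h2 : μ A = 0 := (klDiv_ne_top_iff.1 h).1 h1
    rw [measureReal_def, h2] at hμA
    norm_num at hμA
  have hle : ν.real A ≤ 1 := measureReal_le_one
  -- This t makes (exp t - 1) ν(A) = 1 - ν(A) ≤ 1, while t ≥ 0 gives t/2 ≤ t μ(A); hence t ≤ 2 KL +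
  -- 2.
  have h1 := mul_measureReal_le_toReal_klDiv_add h A (-Real.log (ν.real A))
  rw [Real.exp_neg, Real.exp_log hpos, sub_mul, inv_mul_cancel₀ hpos.ne'] at h1
  have hlog : Real.log (ν.real A) ≤ 0 := Real.log_nonpos hpos.le hle
  rw [← Real.le_log_iff_exp_le hpos]
  nlinarith

/-! ### Exponential moments of the deviations. -/

/-- Hoeffding's lemma for the frequency of an event in an i.i.d. sample. -/
theorem lintegral_exp_sub_frequency_le {Z : Type*} [MeasurableSpace Z] (D : Measure Z)
    [IsProbabilityMeasure D] {m : ℕ} (hm : 0 < m) {B : Set Z} (hB : MeasurableSet B) (t : ℝ) :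
    ∫⁻ S, ENNReal.ofReal (Real.exp (t * (D.real B -
      1 / (m : ℝ) * ∑ i, B.indicator (fun _ => (1 : ℝ)) (S i)) - t ^ 2 / (8 * m)))
        ∂(Measure.pi fun _ : Fin m => D) ≤ 1 := by
  have hm' : (0 : ℝ) < m := by exact_mod_cast hm
  set b : Z → ℝ := B.indicator (fun _ => (1 : ℝ)) with hb
  have hbm : Measurable b := measurable_const.indicator hB
  have hb01 : ∀ z, b z ∈ Set.Icc (0 : ℝ) 1 := fun z => by
    by_cases h : z ∈ B <;> simp [hb, h]
  have hmean : ∫ z, b z ∂D = D.real B := by simp [hb, integral_indicator hB]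
  -- Values in [0, 1] give variance proxy 1/4, so each of the m factors at -t/m is at most
  -- exp(t²/(8m²)).
  have hsub := hasSubgaussianMGF_of_mem_Icc (μ := D) hbm.aemeasurable (ae_of_all _ hb01)
  rw [hmean] at hsub
  have hmgf := hsub.mgf_le (-(t / m))
  have hfac : ∀ S : Fin m → Z,
      Real.exp (t * (D.real B - 1 / (m : ℝ) * ∑ i, b (S i)) - t ^ 2 / (8 * m)) =
        Real.exp (-(t ^ 2 / (8 * m))) * ∏ i, Real.exp (-(t / m) * (b (S i) - D.real B)) := by
    intro S
    rw [← Real.exp_sum, ← Real.exp_add, ← Finset.mul_sum, Finset.sum_sub_distrib]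
    congr 1
    simp only [Finset.sum_const, Finset.card_univ, Fintype.card_fin, nsmul_eq_mul]
    field_simp
    ring
  have hint : Integrable (fun S : Fin m → Z =>
      ∏ i, Real.exp (-(t / m) * (b (S i) - D.real B))) (Measure.pi fun _ : Fin m => D) :=
    Integrable.fintype_prod (f := fun _ z => Real.exp (-(t / m) * (b z - D.real B)))
      fun _ => hsub.integrable_exp_mul _
  rw [← ofReal_integral_eq_lintegral_ofReal]
  · rw [ENNReal.ofReal_le_one]
    simp_rw [hfac]
    rw [integral_const_mul,
      integral_fintype_prod_eq_pow (fun z => Real.exp (-(t / m) * (b z - D.real B))),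
      Fintype.card_fin]
    calc Real.exp (-(t ^ 2 / (8 * m))) * (∫ z, Real.exp (-(t / m) * (b z - D.real B)) ∂D) ^ m
        ≤ Real.exp (-(t ^ 2 / (8 * m))) * Real.exp (t ^ 2 / (8 * m ^ 2)) ^ m := by
          refine mul_le_mul_of_nonneg_left (pow_le_pow_left₀
            (integral_nonneg fun z => (Real.exp_pos _).le) (hmgf.trans (le_of_eq ?_)) m)
            (Real.exp_pos _).le
          congr 1
          simp
          field_simp
          norm_num
          ring
      _ = 1 := by
          rw [← Real.exp_nat_mul, ← Real.exp_add, Real.exp_eq_one_iff]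
          field_simp
          ring
  · simp_rw [hfac]
    exact hint.const_mul _
  · exact ae_of_all _ fun _ => (Real.exp_pos _).le

/-- With high probability over the sample, the exponential moments of the deviations between
probability and frequency, averaged over a prior, are bounded on a grid of exponents. -/
theorem exists_set_forall_lintegral_exp_le {W Z : Type*} [MeasurableSpace W] [MeasurableSpace Z]
    {m : ℕ} (hm : 0 < m) (B : W → Set Z) (hB : MeasurableSet {p : W × Z | p.2 ∈ B p.1})
    (D : Measure Z) [IsProbabilityMeasure D] (P : Measure W) [IsProbabilityMeasure P]
    (t : ℕ → ℝ) (n : ℕ) {δ : ℝ} (hδ : 0 < δ) :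
    ∃ G : Set (Fin m → Z), MeasurableSet G ∧
      1 - δ ≤ (Measure.pi fun _ : Fin m => D).real G ∧
      ∀ S ∈ G, ∀ j < n, ∫⁻ w, ENNReal.ofReal (Real.exp (t j * (D.real (B w) -
        1 / (m : ℝ) * ∑ i, (B w).indicator (fun _ => (1 : ℝ)) (S i)) - t j ^ 2 / (8 * m))) ∂P ≤
          ENNReal.ofReal (n / δ) := by
  set E : ℕ → W → (Fin m → Z) → ENNReal := fun j w S =>
    ENNReal.ofReal (Real.exp (t j * (D.real (B w) -
      1 / (m : ℝ) * ∑ i, (B w).indicator (fun _ => (1 : ℝ)) (S i)) - t j ^ 2 / (8 * m))) with hE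
  have hBw : ∀ w, MeasurableSet (B w) := fun w => measurable_prodMk_left hB
  have hrisk : Measurable fun w => D.real (B w) :=
    (measurable_measure_prodMk_left hB).ennreal_toReal
  have hind : ∀ i : Fin m, Measurable fun p : W × (Fin m → Z) =>
      (B p.1).indicator (fun _ => (1 : ℝ)) (p.2 i) := fun i =>
    (measurable_const.indicator hB : Measurable
      ({p : W × Z | p.2 ∈ B p.1}.indicator fun _ => (1 : ℝ))).comp
        (by fun_prop : Measurable fun p : W × (Fin m → Z) => (p.1, p.2 i))
  have hEm : ∀ j, Measurable fun p : W × (Fin m → Z) => E j p.1 p.2 := fun j => by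
    have h1 : Measurable fun p : W × (Fin m → Z) => D.real (B p.1) := hrisk.comp measurable_fst
    have h2 : Measurable fun p : W × (Fin m → Z) =>
        ∑ i, (B p.1).indicator (fun _ => (1 : ℝ)) (p.2 i) :=
      Finset.measurable_sum _ fun i _ => hind i
    exact (Real.measurable_exp.comp
      (((h1.sub (h2.const_mul _)).const_mul _).sub_const _)).ennreal_ofReal
  -- One application of Markov to the sum, whose mean is at most n, bounds every term at once.
  set V : (Fin m → Z) → ENNReal := fun S => ∑ j ∈ Finset.range n, ∫⁻ w, E j w S ∂P with hV
  have hVm : Measurable V :=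
    Finset.measurable_sum _ fun j _ => (hEm j).lintegral_prod_left'
  have hVint : ∫⁻ S, V S ∂(Measure.pi fun _ : Fin m => D) ≤ n := by
    rw [hV, lintegral_finsetSum _ fun j _ => (hEm j).lintegral_prod_left']
    calc ∑ j ∈ Finset.range n, ∫⁻ S, ∫⁻ w, E j w S ∂P ∂(Measure.pi fun _ : Fin m => D)
        ≤ ∑ j ∈ Finset.range n, 1 := by
          refine Finset.sum_le_sum fun j _ => ?_
          rw [lintegral_lintegral_swap (f := fun S w => E j w S)
            ((hEm j).comp measurable_swap).aemeasurable]
          calc _ ≤ ∫⁻ _ : W, 1 ∂P :=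
                lintegral_mono fun w => lintegral_exp_sub_frequency_le D hm (hBw w) (t j)
            _ = 1 := by simp
      _ = n := by simp
  rcases Nat.eq_zero_or_pos n with rfl | hn
  · exact ⟨Set.univ, MeasurableSet.univ, by simp [hδ.le], by simp⟩
  have hn' : (0 : ℝ) < n := by exact_mod_cast hn
  have hε : ENNReal.ofReal (n / δ) ≠ 0 := by
    rw [Ne, ENNReal.ofReal_eq_zero, not_le]; positivity
  have hbad : MeasurableSet {S | ENNReal.ofReal (n / δ) ≤ V S} :=
    measurableSet_le measurable_const hVm
  refine ⟨{S | ENNReal.ofReal (n / δ) ≤ V S}ᶜ, hbad.compl, ?_, fun S hS j hj => ?_⟩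
  · rw [probReal_compl_eq_one_sub hbad]
    have h1 : (Measure.pi fun _ : Fin m => D) {S | ENNReal.ofReal (n / δ) ≤ V S} ≤
        ENNReal.ofReal δ := by
      refine (meas_ge_le_lintegral_div hVm.aemeasurable hε ENNReal.ofReal_ne_top).trans ?_
      refine ENNReal.div_le_of_le_mul (hVint.trans (le_of_eq ?_))
      rw [← ENNReal.ofReal_mul hδ.le, mul_div_cancel₀ _ hδ.ne', ENNReal.ofReal_natCast]
    have h2 := ENNReal.toReal_le_of_le_ofReal hδ.le h1
    rw [measureReal_def]
    linarith
  · have h1 : V S ≤ ENNReal.ofReal (n / δ) := (not_le.1 (Set.notMem_of_mem_compl hS)).le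
    exact (Finset.single_le_sum (f := fun j => ∫⁻ w, E j w S ∂P) (fun _ _ => zero_le)
      (Finset.mem_range.2 hj)).trans h1

/-! ### Margins and error sets. -/

theorem measurableSet_mem_errorSet {W X : Type*} [MeasurableSpace W] [MeasurableSpace X] {k : ℕ}
    {f : W → X → Fin k → ℝ} (hf : Measurable (Function.uncurry f)) (γ : ℝ) :
    MeasurableSet {p : W × (X × Fin k) | p.2 ∈ errorSet γ (f p.1)} := by
  have hg : ∀ y : Fin k, Measurable fun p : W × (X × Fin k) => f p.1 p.2.1 y := fun y =>
    (measurable_pi_apply y).comp (hf.comp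
      (by fun_prop : Measurable fun p : W × (X × Fin k) => (p.1, p.2.1)))
  have hy : ∀ y : Fin k, MeasurableSet {p : W × (X × Fin k) | p.2.2 = y} := fun y =>
    (by fun_prop : Measurable fun p : W × (X × Fin k) => p.2.2) (measurableSet_singleton y)
  -- With y and j fixed, only fixed coordinates of the scores are compared.
  have heq : {p : W × (X × Fin k) | p.2 ∈ errorSet γ (f p.1)} =
      ⋃ (y : Fin k) (j : Fin k) (_ : j ≠ y),
        {p | p.2.2 = y} ∩ {p | f p.1 p.2.1 y ≤ γ + f p.1 p.2.1 j} := by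
    ext ⟨w, x, y⟩
    simp [mem_errorSet_iff]
  rw [heq]
  exact MeasurableSet.iUnion fun y => MeasurableSet.iUnion fun j => MeasurableSet.iUnion fun _ =>
    (hy y).inter (measurableSet_le (hg y) ((hg j).const_add γ))

theorem supDist_comm {X : Type*} {k : ℕ} (g h : X → Fin k → ℝ) : supDist g h = supDist h g := by
  simp only [supDist, enorm_sub_rev]

/-- Uniformly `ε`-close score functions have nested error sets at margins `2ε` apart. -/
theorem errorSet_subset_of_supDist_lt {X : Type*} {k : ℕ} {g h : X → Fin k → ℝ} {ε γ γ' : ℝ}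
    (hgh : supDist g h < ENNReal.ofReal ε) (hγ : γ + 2 * ε ≤ γ') :
    errorSet γ g ⊆ errorSet γ' h := by
  rintro ⟨x, y⟩ hz
  obtain ⟨j, hj, hle⟩ := (mem_errorSet_iff _ _ _).1 hz
  have hx : ∀ i, |g x i - h x i| < ε := fun i => by
    have h1 : ‖g x - h x‖ₑ < ENNReal.ofReal ε :=
      (le_iSup (fun x => ‖g x - h x‖ₑ) x).trans_lt hgh
    rw [← ofReal_norm] at h1
    have h2 := (ENNReal.ofReal_lt_ofReal_iff_of_nonneg (norm_nonneg _)).1 h1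
    exact (norm_le_pi_norm (g x - h x) i).trans_lt h2
  -- A margin compares two scores, each moved by less than ε; hence 2ε.
  have h1 := abs_lt.1 (hx y)
  have h2 := abs_lt.1 (hx j)
  exact (mem_errorSet_iff _ _ _).2 ⟨j, hj, by simp only at hle ⊢; linarith⟩

theorem empiricalMarginLoss_mono {X : Type*} {k m : ℕ} (S : Fin m → X × Fin k) {γ γ' : ℝ}
    {g h : X → Fin k → ℝ} (hgh : errorSet γ g ⊆ errorSet γ' h) :
    empiricalMarginLoss S γ g ≤ empiricalMarginLoss S γ' h := by
  unfold empiricalMarginLoss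
  gcongr

theorem empiricalMarginLoss_nonneg {X : Type*} {k m : ℕ} (S : Fin m → X × Fin k) (γ : ℝ)
    (g : X → Fin k → ℝ) : 0 ≤ empiricalMarginLoss S γ g :=
  mul_nonneg (by positivity) (Finset.sum_nonneg fun _ _ =>
    Set.indicator_nonneg (fun _ _ => zero_le_one) _)

/-! ### Optimising the exponent and the final bound. -/

/-- The numerical step: a deviation `Δ` whose exponential moment at the grid point nearest to the
optimum is controlled is bounded by the complexity term. -/
theorem le_four_mul_sqrt_of_exp_bound {m : ℕ} (hm : 2 ≤ m) {Δ K δ : ℝ} (hΔ : 0 ≤ Δ) (hδ : 0 < δ)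
    (hδ1 : δ ≤ 1)
    (h : Real.exp (-(2 * K + 2)) * Real.exp (4 * (⌊m * Δ⌋₊ : ℝ) * Δ -
      (4 * (⌊m * Δ⌋₊ : ℝ)) ^ 2 / (8 * m)) ≤ (m + 1) / δ) :
    Δ ≤ 4 * Real.sqrt ((K + Real.log (6 * (m : ℝ) / δ)) / ((m : ℝ) - 1)) := by
  have hm2 : (2 : ℝ) ≤ m := by exact_mod_cast hm
  have hm0 : (0 : ℝ) < m := by linarith
  set j : ℝ := (⌊m * Δ⌋₊ : ℝ)
  have hj1 : j ≤ m * Δ := Nat.floor_le (by positivity)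
  have hj2 : m * Δ < j + 1 := Nat.lt_floor_add_one _
  -- Completing the square: rounding mΔ down to j costs 2(mΔ - j)²/m ≤ 2/m ≤ 1.
  have hopt : 2 * m * Δ ^ 2 - 1 ≤ 4 * j * Δ - (4 * j) ^ 2 / (8 * m) := by
    have h1 : 4 * j * Δ - (4 * j) ^ 2 / (8 * m) =
        2 * m * Δ ^ 2 - 2 * (m * Δ - j) ^ 2 / m := by field_simp; ring
    have h2 : 2 * (m * Δ - j) ^ 2 / m ≤ 1 := by
      rw [div_le_one hm0]; nlinarith
    linarith
  rw [← Real.exp_add, ← Real.le_log_iff_exp_le (by positivity)] at h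
  have he : Real.exp 3 ≤ 21 := by
    have h3 : Real.exp 3 = Real.exp 1 ^ 3 := by rw [← Real.exp_nat_mul]; norm_num
    have h1 : Real.exp 1 ≤ 2.75 := by linarith [Real.exp_one_lt_d9]
    calc Real.exp 3 = Real.exp 1 ^ 3 := h3
      _ ≤ 2.75 ^ 3 := by gcongr
      _ ≤ 21 := by norm_num
  -- The 3 is 2 from the change of measure plus 1 from rounding.
  have hlog : 3 + Real.log ((m + 1) / δ) ≤ 2 * Real.log (6 * m / δ) := by
    rw [← Real.log_exp 3, ← Real.log_mul (by positivity) (by positivity),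
      show (2 : ℝ) * Real.log (6 * m / δ) = Real.log ((6 * m / δ) ^ 2) by
        rw [Real.log_pow]; norm_num]
    refine Real.log_le_log (by positivity) ?_
    calc Real.exp 3 * ((m + 1) / δ) ≤ 21 * ((m + 1) / δ) := by gcongr
      _ = 21 * (m + 1) * δ / δ ^ 2 := by field_simp
      _ ≤ (36 * m ^ 2) / δ ^ 2 := by
          exact div_le_div_of_nonneg_right (by nlinarith) (by positivity)
      _ = (6 * m / δ) ^ 2 := by field_simp; norm_num
  have hlogpos : 0 ≤ Real.log (6 * m / δ) :=
    Real.log_nonneg (by rw [le_div_iff₀ hδ]; linarith)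
  have hΔ2 : m * Δ ^ 2 ≤ K + Real.log (6 * m / δ) := by linarith
  -- The bound already holds with constant 1; m - 1 and the factor 4 only weaken it.
  have hsq : Δ ≤ Real.sqrt ((K + Real.log (6 * (m : ℝ) / δ)) / ((m : ℝ) - 1)) := by
    refine Real.le_sqrt_of_sq_le ?_
    rw [le_div_iff₀ (by linarith)]
    nlinarith [sq_nonneg Δ]
  linarith [Real.sqrt_nonneg ((K + Real.log (6 * (m : ℝ) / δ)) / ((m : ℝ) - 1))]

end PACBayesMargin

theorem mainTheorem3 {W X : Type*} [AddCommGroup W] [MeasurableSpace W] [MeasurableAdd W]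
    [MeasurableSpace X] {k m : ℕ} (hm : 2 ≤ m)
    (f : W → X → Fin k → ℝ) (hf : Measurable (Function.uncurry f))
    (D : Measure (X × Fin k)) [IsProbabilityMeasure D]
    (P : Measure W) [IsProbabilityMeasure P]
    (γ δ : ℝ) (hγ : 0 < γ) (hδ : 0 < δ) :
    ∃ G : Set (Fin m → X × Fin k), MeasurableSet G ∧
      1 - δ ≤ (Measure.pi fun _ : Fin m => D).real G ∧
      ∀ S ∈ G, ∀ (w : W) (U : Measure W), IsProbabilityMeasure U →
        1 / 2 ≤ U {u | PACBayesMargin.supDist (f (w + u)) (f w) < ENNReal.ofReal (γ / 4)} →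
        InformationTheory.klDiv (U.map fun u => w + u) P ≠ ⊤ →
        PACBayesMargin.marginLoss D 0 (f w) ≤
          PACBayesMargin.empiricalMarginLoss S γ (f w) +
            4 * Real.sqrt
              (((InformationTheory.klDiv (U.map fun u => w + u) P).toReal
                + Real.log (6 * (m : ℝ) / δ)) / ((m : ℝ) - 1)) := by
  -- For δ > 1 the empty event suffices; the numerical step needs δ ≤ 1.
  rcases lt_or_ge 1 δ with hδ1 | hδ1
  · exact ⟨∅, MeasurableSet.empty, by simp [hδ1.le], by simp⟩
  have hm0 : 0 < m := by omega
  have hBm := PACBayesMargin.measurableSet_mem_errorSet hf (γ / 2)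
  -- As 0 < Δ ≤ 1 below, rounding 4mΔ down to a multiple of 4 lands among the m + 1 values 0, 4, …,
  -- 4m.
  obtain ⟨G, hGm, hGp, hG⟩ := PACBayesMargin.exists_set_forall_lintegral_exp_le hm0
    (fun w => PACBayesMargin.errorSet (γ / 2) (f w)) hBm D P (fun j => 4 * (j : ℝ)) (m + 1) hδ
  refine ⟨G, hGm, hGp, fun S hS w U hU hhalf hkl => ?_⟩
  have hadd : Measurable fun u : W => w + u := measurable_const_add w
  have : IsProbabilityMeasure (U.map fun u => w + u) :=
    Measure.isProbabilityMeasure_map hadd.aemeasurable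
  set Q := U.map fun u => w + u
  rw [← sub_le_iff_le_add']
  set Δ := PACBayesMargin.marginLoss D 0 (f w) - PACBayesMargin.empiricalMarginLoss S γ (f w)
  rcases le_or_gt Δ 0 with hΔ0 | hΔ0
  · exact hΔ0.trans (by positivity)
  have hΔ1 : Δ ≤ 1 := by
    have h1 : PACBayesMargin.marginLoss D 0 (f w) ≤ 1 := measureReal_le_one
    linarith [PACBayesMargin.empiricalMarginLoss_nonneg S γ (f w)]
  let A : Set W := {w' | Δ ≤ PACBayesMargin.marginLoss D (γ / 2) (f w') -
    PACBayesMargin.empiricalMarginLoss S (γ / 2) (f w')}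
  have hAm : MeasurableSet A := by
    refine measurableSet_le measurable_const (Measurable.sub ?_ ?_)
    · exact (measurable_measure_prodMk_left hBm).ennreal_toReal
    · exact (Finset.measurable_sum _ fun i _ =>
        (measurable_const.indicator hBm : Measurable ({p : W × (X × Fin k) |
          p.2 ∈ PACBayesMargin.errorSet (γ / 2) (f p.1)}.indicator fun _ => (1 : ℝ))).comp
            (measurable_prodMk_right (y := S i))).const_mul _
  have hsub : {u | PACBayesMargin.supDist (f (w + u)) (f w) < ENNReal.ofReal (γ / 4)} ⊆
      (fun u => w + u) ⁻¹' A := by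
    intro u hu
    have h1 : PACBayesMargin.marginLoss D 0 (f w) ≤
        PACBayesMargin.marginLoss D (γ / 2) (f (w + u)) :=
      measureReal_mono (PACBayesMargin.errorSet_subset_of_supDist_lt
        (by rwa [PACBayesMargin.supDist_comm]) (by linarith))
    have h2 : PACBayesMargin.empiricalMarginLoss S (γ / 2) (f (w + u)) ≤
        PACBayesMargin.empiricalMarginLoss S γ (f w) :=
      PACBayesMargin.empiricalMarginLoss_mono S
        (PACBayesMargin.errorSet_subset_of_supDist_lt hu (by linarith))
    change Δ ≤ _
    linarith
  have hQA : 1 / 2 ≤ Q.real A := by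
    -- Only A has to be measurable: the perturbation event enters by monotonicity of the outer
    -- measure.
    have h1 : (1 / 2 : ENNReal) ≤ Q A := by
      rw [Measure.map_apply hadd hAm]
      exact hhalf.trans (measure_mono hsub)
    simpa [measureReal_def] using ENNReal.toReal_mono (measure_ne_top Q A) h1
  have hPA := PACBayesMargin.exp_neg_klDiv_le_measureReal hkl hQA
  refine PACBayesMargin.le_four_mul_sqrt_of_exp_bound hm hΔ0.le hδ hδ1 ?_
  set j := ⌊m * Δ⌋₊
  have hj : j < m + 1 := by
    have h1 : m * Δ ≤ m := mul_le_of_le_one_right (by positivity) hΔ1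
    exact Nat.lt_succ_of_le (Nat.floor_le_of_le h1)
  -- Restrict the prior average to A, where the gap is at least Δ; the exponent 4j is nonnegative.
  have hexp : ENNReal.ofReal (Real.exp (4 * (j : ℝ) * Δ - (4 * (j : ℝ)) ^ 2 / (8 * m))) * P A ≤
      ENNReal.ofReal ((m + 1 : ℕ) / δ) := by
    refine le_trans ?_ (hG S hS j hj)
    rw [← setLIntegral_const]
    refine (setLIntegral_mono' hAm fun w' hw' => ?_).trans (setLIntegral_le_lintegral A _)
    gcongr
    exact hw'
  have hreal := ENNReal.toReal_le_of_le_ofReal (by positivity) hexp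
  rw [ENNReal.toReal_mul, ENNReal.toReal_ofReal (Real.exp_pos _).le, ← measureReal_def] at hreal
  push_cast at hreal
  refine le_trans ?_ hreal
  rw [mul_comm]
  gcongr
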